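/- A dilation matrix is a matrix $A\in M_m(\mathbb{Z})$ all of whose complex eigenvalues $\lambda$ satisfy $|\lambda|>1$. A digit set for $A$ is a set $D\subset\mathbb{Z}^m$ that contains exactly one representative of each coset in $\mathbb{Z}^m/A\mathbb{Z}^m$. The attractor $T(A,D)$ of the iterated function system $f_d(x)=A^{-1}(x+d)$, $d\in D$, is the unique nonempty compact set $T\subset\mathbb{R}^m$ with $T=\bigcup_{d\in D}f_d(T)$. Let $A$ be any dilation matrix all of whose eigenvalues are rational. Then there exists a digit set $D_A$ for $A$ such that the attractor $T(A,D_A)$ exists, is unique, and is connected. -/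

import Mathlib

/-- `μ` is a (complex) eigenvalue of the integer matrix `A`. -/
def IsEigenvalueOf {m : ℕ} (A : Matrix (Fin m) (Fin m) ℤ) (μ : ℂ) : Prop :=
  Module.End.HasEigenvalue (Matrix.toLin' (A.map (Int.cast : ℤ → ℂ))) μ

/-- A dilation matrix: an integer matrix all of whose complex eigenvalues have modulus `> 1`. -/
def IsDilationMatrix {m : ℕ} (A : Matrix (Fin m) (Fin m) ℤ) : Prop :=
  ∀ μ : ℂ, IsEigenvalueOf A μ → 1 < ‖μ‖

/-- A (basic) digit set for `A`: a complete set of coset representatives of `ℤ^m / A ℤ^m`,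
with exactly one representative from each coset. -/
def IsDigitSet {m : ℕ} (A : Matrix (Fin m) (Fin m) ℤ) (D : Set (Fin m → ℤ)) : Prop :=
  Set.BijOn (LinearMap.range A.mulVecLin).mkQ D Set.univ

/-- The map `f_d(x) = A⁻¹ (x + d)` on `ℝ^m`. -/
noncomputable def digitMap {m : ℕ} (A : Matrix (Fin m) (Fin m) ℤ) (d : Fin m → ℤ)
    (x : Fin m → ℝ) : Fin m → ℝ :=
  (A.map (Int.cast : ℤ → ℝ))⁻¹.mulVec (x + fun i => (d i : ℝ))

/-- `T` is an attractor of the iterated function system `{f_d : d ∈ D}`: a nonempty compact set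
with `T = ⋃_{d ∈ D} f_d(T)`. -/
structure IsAttractor {m : ℕ} (A : Matrix (Fin m) (Fin m) ℤ) (D : Set (Fin m → ℤ))
    (T : Set (Fin m → ℝ)) : Prop where
  nonempty : T.Nonempty
  isCompact : IsCompact T
  self_affine : T = ⋃ d ∈ D, digitMap A d '' T

/-! Rational eigenvalues of an integer matrix are integers, so `A` is conjugate over `ℤ` to a
triangular `M` with diagonal entries `c i`, `|c i| ≥ 2`. Conjugating further by a diagonal matrix
with entries `r i`, one gets a real matrix `B`, still triangular with diagonal `c` but with
off-diagonal row sums at most `1/4`. Each `r i` is coprime to `c i`, so the box of vectors `k` with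
`0 ≤ k i < |c i|`, carried back to the original coordinates, is a digit set for `A`. It remains to
treat `B` with the box as digits.

In the sup norm `B⁻¹` contracts by `4/7`, which gives a unique attractor `T`. For connectedness it
suffices that every standard basis vector `e i` lies in `T - T`: then the pieces of `d` and `d - e
i` meet, and unit steps link every digit of the box to `0`. To see that `e i ∈ T - T`, one enlarges
the set of basis vectors to the bounded set `unitLikeVectors`, in which every `v` has a successor `B
v - δ` with `δ` a difference of digits (`exists_sub_mem_unitLikeVectors`). Since `T - T` is stable
under `y ↦ B⁻¹ (y + δ)`, each such step back contracts the distance to `T - T`, so that distance is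
`0`. -/

/-! ### Contracting iterated function systems: existence, uniqueness, connectedness -/

section IteratedFunctionSystem

open Metric Set Bornology

variable {E α : Type*} [MetricSpace E]

/-- If every point `x` of a bounded set `C` has a companion `y ∈ C` with
`infDist x S ≤ ρ * infDist y S`, where `ρ < 1`, then `C` is contained in the closed set `S`. -/
theorem subset_of_infDist_le_mul_infDist {C S : Set E} (hC : IsBounded C) (hS : IsClosed S)
    (hne : S.Nonempty) {ρ : ℝ} (h0 : 0 ≤ ρ) (h1 : ρ < 1)
    (h : ∀ x ∈ C, ∃ y ∈ C, infDist x S ≤ ρ * infDist y S) : C ⊆ S := by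
  obtain ⟨s, hs⟩ := hne
  obtain ⟨c, hc⟩ := hC.subset_closedBall s
  have key : ∀ n : ℕ, ∀ x ∈ C, infDist x S ≤ ρ ^ n * c := by
    intro n
    induction n with
    | zero =>
      intro x hx
      simpa using (infDist_le_dist_of_mem hs).trans (mem_closedBall.1 (hc hx))
    | succ n ih =>
      intro x hx
      obtain ⟨y, hy, hxy⟩ := h x hx
      calc infDist x S ≤ ρ * infDist y S := hxy
        _ ≤ ρ * (ρ ^ n * c) := by gcongr; exact ih y hy
        _ = ρ ^ (n + 1) * c := by ring
  intro x hx
  rw [hS.mem_iff_infDist_zero ⟨s, hs⟩]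
  have hlim : Filter.Tendsto (fun n : ℕ => ρ ^ n * c) Filter.atTop (nhds (0 * c)) :=
    (tendsto_pow_atTop_nhds_zero_of_lt_one h0 h1).mul_const c
  rw [zero_mul] at hlim
  exact le_antisymm (ge_of_tendsto' hlim fun n => key n x hx) infDist_nonneg

theorem infDist_le_mul_infDist_of_mapsTo {S : Set E} (hne : S.Nonempty) {g : E → E} {ρ : ℝ}
    (h0 : 0 ≤ ρ) (hg : ∀ x y, dist (g x) (g y) ≤ ρ * dist x y) (hS : MapsTo g S S) (x : E) :
    infDist (g x) S ≤ ρ * infDist x S := by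
  rcases h0.eq_or_lt with rfl | hpos
  · obtain ⟨s, hs⟩ := hne
    simpa using (infDist_le_dist_of_mem (hS hs)).trans (hg x s)
  · rw [← div_le_iff₀' hpos, le_infDist hne]
    intro y hy
    rw [div_le_iff₀' hpos]
    exact (infDist_le_dist_of_mem (hS hy)).trans (hg x y)

/-- Uniqueness of the attractor of a contracting iterated function system. -/
theorem attractor_unique {D : Set α} {f : α → E → E} {ρ : ℝ} (h0 : 0 ≤ ρ) (h1 : ρ < 1)
    (hf : ∀ d ∈ D, ∀ x y, dist (f d x) (f d y) ≤ ρ * dist x y) {K L : Set E}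
    (hKne : K.Nonempty) (hK : IsCompact K) (hKe : K = ⋃ d ∈ D, f d '' K)
    (hLne : L.Nonempty) (hL : IsCompact L) (hLe : L = ⋃ d ∈ D, f d '' L) : K = L := by
  have key : ∀ {K L : Set E}, IsCompact K → K = ⋃ d ∈ D, f d '' K → L.Nonempty →
      IsCompact L → L = ⋃ d ∈ D, f d '' L → K ⊆ L := by
    intro K L hK hKe hLne hL hLe
    refine subset_of_infDist_le_mul_infDist hK.isBounded hL.isClosed hLne h0 h1 fun x hx => ?_
    rw [hKe] at hx
    simp only [mem_iUnion, mem_image] at hx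
    obtain ⟨d, hd, y, hy, rfl⟩ := hx
    refine ⟨y, hy, infDist_le_mul_infDist_of_mapsTo hLne h0 (hf d hd) (fun z hz => ?_) y⟩
    rw [hLe]
    exact mem_biUnion hd (mem_image_of_mem _ hz)
  exact (key hK hKe hLne hL hLe).antisymm (key hL hLe hKne hK hKe)

/-- Existence of the attractor of a finite system of injective contractions. -/
theorem exists_attractor [ProperSpace E] [Nonempty E] {D : Set α} (hD : D.Finite)
    (hDne : D.Nonempty) {f : α → E → E} {ρ : ℝ} (h0 : 0 ≤ ρ) (h1 : ρ < 1)
    (hf : ∀ d ∈ D, ∀ x y, dist (f d x) (f d y) ≤ ρ * dist x y)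
    (hinj : ∀ d ∈ D, Function.Injective (f d)) :
    ∃ T : Set E, T.Nonempty ∧ IsCompact T ∧ T = ⋃ d ∈ D, f d '' T := by
  let F : Set E → Set E := fun K => ⋃ d ∈ D, f d '' K
  have hFmono : Monotone F := fun K L h => biUnion_mono subset_rfl fun d _ => image_mono h
  have hcont : ∀ d ∈ D, Continuous (f d) := fun d hd =>
    (LipschitzWith.of_dist_le_mul (K := ⟨ρ, h0⟩) (hf d hd)).continuous
  have hFc : ∀ K, IsCompact K → IsCompact (F K) := fun K hK =>
    hD.isCompact_biUnion fun d hd => hK.image (hcont d hd)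
  have hFne : ∀ K : Set E, K.Nonempty → (F K).Nonempty := by
    rintro K ⟨x, hx⟩
    obtain ⟨d, hd⟩ := hDne
    exact ⟨f d x, mem_biUnion hd (mem_image_of_mem _ hx)⟩
  obtain ⟨x₀⟩ := ‹Nonempty E›
  obtain ⟨M, hM⟩ := (hD.image fun d => dist (f d x₀) x₀).bddAbove
  have hM' : ∀ d ∈ D, dist (f d x₀) x₀ ≤ M := fun d hd => hM (mem_image_of_mem _ hd)
  have hM0 : 0 ≤ M := by
    obtain ⟨d, hd⟩ := hDne
    exact dist_nonneg.trans (hM' d hd)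
  have hρ : 0 < 1 - ρ := by linarith
  let K₀ := closedBall x₀ (M / (1 - ρ))
  -- The radius `M / (1 - ρ)` is the fixed point of `t ↦ ρ * t + M`.
  have hK₀ : F K₀ ⊆ K₀ := by
    refine iUnion₂_subset fun d hd => ?_
    rintro _ ⟨x, hx, rfl⟩
    rw [mem_closedBall] at hx ⊢
    calc dist (f d x) x₀ ≤ dist (f d x) (f d x₀) + dist (f d x₀) x₀ := dist_triangle _ _ _
      _ ≤ ρ * (M / (1 - ρ)) + M := by
        gcongr
        · exact (hf d hd _ _).trans (by gcongr)
        · exact hM' d hd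
      _ = M / (1 - ρ) := by field_simp; ring
  let K : ℕ → Set E := fun n => F^[n] K₀
  have hKs : ∀ n, K (n + 1) = F (K n) := fun n => Function.iterate_succ_apply' F n K₀
  have hKanti : ∀ n, K (n + 1) ⊆ K n := by
    intro n
    induction n with
    | zero => exact hK₀
    | succ n ih => rw [hKs (n + 1)]; nth_rewrite 2 [hKs n]; exact hFmono ih
  have hKcpt : ∀ n, IsCompact (K n) := by
    intro n
    induction n with
    | zero => exact isCompact_closedBall _ _
    | succ n ih => rw [hKs]; exact hFc _ ih
  have hKne : ∀ n, (K n).Nonempty := by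
    intro n
    induction n with
    | zero => exact ⟨x₀, mem_closedBall_self (by positivity)⟩
    | succ n ih => rw [hKs]; exact hFne _ ih
  have hanti : Antitone K := antitone_nat_of_succ_le hKanti
  refine ⟨⋂ n, K n, ?_, ?_, ?_⟩
  · exact IsCompact.nonempty_iInter_of_sequence_nonempty_isCompact_isClosed K hKanti hKne
      (hKcpt 0) fun n => (hKcpt n).isClosed
  · exact (hKcpt 0).of_isClosed_subset (isClosed_iInter fun n => (hKcpt n).isClosed)
      (iInter_subset K 0)
  · apply Subset.antisymm
    · intro x hx
      rw [mem_iInter] at hx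
      have hx' : ∀ n, ∃ d ∈ D, ∃ y ∈ K n, f d y = x := by
        intro n
        have := hx (n + 1)
        rw [hKs] at this
        simpa [F] using this
      choose d hd y hy hxy using hx'
      have : Finite D := hD
      -- Some digit `e` occurs for infinitely many `n`. By injectivity of `f e` the preimages `y n`
      -- agree along these `n`, so a single point lies in every `K n`.
      obtain ⟨⟨e, heD⟩, he⟩ := Finite.exists_infinite_fiber fun n => (⟨d n, hd n⟩ : D)
      rw [infinite_coe_iff] at he
      have hfib : ∀ n, ∃ k, n < k ∧ d k = e := by
        intro n
        obtain ⟨k, hk, hnk⟩ := he.exists_gt n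
        exact ⟨k, hnk, by simpa using hk⟩
      obtain ⟨k₀, -, hk₀⟩ := hfib 0
      refine mem_biUnion heD ⟨y k₀, mem_iInter.2 fun n => ?_, hk₀ ▸ hxy k₀⟩
      obtain ⟨k, hnk, hk⟩ := hfib n
      have hyk : y k₀ = y k := hinj e heD ((hk₀ ▸ hxy k₀).trans (hk ▸ hxy k).symm)
      exact hyk ▸ hanti hnk.le (hy k)
    · refine iUnion₂_subset fun d hd => ?_
      rintro _ ⟨x, hx, rfl⟩
      rw [mem_iInter] at hx ⊢
      intro n
      apply hKanti n
      rw [hKs]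
      exact mem_biUnion hd (mem_image_of_mem _ (hx n))

/-- A compact attractor of a contracting iterated function system is connected as soon as
adjacency of pieces links all pieces: any property of digits that is inherited by digits with an
intersecting piece and holds for one digit holds for all. -/
theorem attractor_isPreconnected {D : Set α} {f : α → E → E} {ρ : ℝ} (h0 : 0 ≤ ρ) (h1 : ρ < 1)
    (hf : ∀ d ∈ D, ∀ x y, dist (f d x) (f d y) ≤ ρ * dist x y) {T : Set E}
    (hT : IsCompact T) (hTe : T = ⋃ d ∈ D, f d '' T)
    (hadj : ∀ p : α → Prop, (∀ d ∈ D, ∀ e ∈ D, (f d '' T ∩ f e '' T).Nonempty → p d → p e) →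
      (∃ d ∈ D, p d) → ∀ d ∈ D, p d) : IsPreconnected T := by
  have hmap : ∀ d ∈ D, ∀ x ∈ T, f d x ∈ T := by
    intro d hd x hx
    rw [hTe]
    exact mem_biUnion hd (mem_image_of_mem _ hx)
  have hmem : ∀ x ∈ T, ∃ d ∈ D, ∃ y ∈ T, f d y = x := by
    intro x hx
    rw [hTe] at hx
    simpa using hx
  obtain ⟨c, hc⟩ := isBounded_iff.1 hT.isBounded
  -- A set that absorbs all jumps within `T` of length at most `ρ ^ n * c` absorbs `T` once it meets
  -- it. For `n = 0` the bound `c` dominates the diameter; in the inductive step `f d ⁻¹' U` absorbs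
  -- jumps longer by a factor `1 / ρ`, so `U` takes in whole pieces and `hadj` spreads this to all
  -- of them.
  have key : ∀ (n : ℕ) (U : Set E),
      (∀ x ∈ T, ∀ y ∈ T, x ∈ U → dist x y ≤ ρ ^ n * c → y ∈ U) → (T ∩ U).Nonempty → T ⊆ U := by
    intro n
    induction n with
    | zero =>
      rintro U hU ⟨x, hxT, hxU⟩ y hy
      exact hU x hxT y hy hxU (by simpa using hc hxT hy)
    | succ n ih =>
      rintro U hU ⟨x, hxT, hxU⟩
      have hpiece : ∀ d ∈ D, (∃ z ∈ T, f d z ∈ U) → ∀ z ∈ T, f d z ∈ U := by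
        rintro d hd ⟨z, hz, hzU⟩
        refine ih (f d ⁻¹' U) (fun a ha b hb haU hab => ?_) ⟨z, hz, hzU⟩
        refine hU _ (hmap d hd a ha) _ (hmap d hd b hb) haU ((hf d hd a b).trans ?_)
        calc ρ * dist a b ≤ ρ * (ρ ^ n * c) := by gcongr
          _ = ρ ^ (n + 1) * c := by ring
      have hall := hadj (fun d => ∀ z ∈ T, f d z ∈ U) (by
        rintro d _ e he ⟨_, ⟨a, ha, rfl⟩, ⟨b, hb, hab⟩⟩ hp
        exact hpiece e he ⟨b, hb, hab ▸ hp a ha⟩) (by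
        obtain ⟨d, hd, y, hy, rfl⟩ := hmem x hxT
        exact ⟨d, hd, hpiece d hd ⟨y, hy, hxU⟩⟩)
      intro y hy
      obtain ⟨d, hd, z, hz, rfl⟩ := hmem y hy
      exact hall d hd z hz
  rw [isPreconnected_closed_iff]
  intro t t' ht ht' hcover hne hne'
  by_contra hempty
  rw [not_nonempty_iff_eq_empty] at hempty
  have hdisj : Disjoint (T ∩ t) (T ∩ t') := by
    rw [disjoint_iff_inter_eq_empty, ← hempty]
    ext; simp; tauto
  -- Disjoint compact and closed parts of `T` have a positive gap; a jump shorter than the gap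
  -- cannot leave `t`, contradicting `key`.
  obtain ⟨δ, hδ, hsep⟩ := hdisj.exists_thickenings (hT.inter_right ht) (hT.isClosed.inter ht')
  have hlim : Filter.Tendsto (fun n : ℕ => ρ ^ n * c) Filter.atTop (nhds (0 * c)) :=
    (tendsto_pow_atTop_nhds_zero_of_lt_one h0 h1).mul_const c
  rw [zero_mul] at hlim
  obtain ⟨n, hn⟩ := (hlim.eventually (gt_mem_nhds hδ)).exists
  have hsub : T ⊆ t := by
    refine key n t (fun x hx y hy hxt hxy => ?_) hne
    by_contra hyt
    have hyt' : y ∈ t' := (hcover hy).resolve_left hyt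
    exact Set.disjoint_left.1 hsep
      (mem_thickening_iff.2 ⟨x, ⟨hx, hxt⟩, by rw [dist_comm]; exact hxy.trans_lt hn⟩)
      (self_subset_thickening hδ _ ⟨hy, hyt'⟩)
  obtain ⟨y, hyT, hyt'⟩ := hne'
  have : y ∈ T ∩ (t ∩ t') := ⟨hyT, hsub hyT, hyt'⟩
  rw [hempty] at this
  exact this

end IteratedFunctionSystem

/-! ### Triangularization over a principal ideal domain -/

section TriangularBasis

open Polynomial Module

theorem Polynomial.comp_aeval_eq_aeval_comp {R M N : Type*} [CommRing R] [AddCommGroup M]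
    [Module R M] [AddCommGroup N] [Module R N] {f : End R M} {g : End R N} (φ : M →ₗ[R] N)
    (h : ∀ x, φ (f x) = g (φ x)) (p : R[X]) (x : M) : φ (aeval f p x) = aeval g p (φ x) := by
  induction p using Polynomial.induction_on' generalizing x with
  | add p q hp hq => simp [hp, hq]
  | monomial n a =>
    have hpow : ∀ (n : ℕ) (x : M), φ ((f ^ n) x) = (g ^ n) (φ x) := by
      intro n
      induction n with
      | zero => simp
      | succ n ih => intro x; rw [pow_succ, pow_succ, Module.End.mul_apply, ih, h]; rfl
    simp [aeval_monomial, hpow]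

/-- An endomorphism of a finite free `R`-module over a principal ideal domain, annihilated by a
product of linear factors `X - a`, `a ∈ s`, is triangular in a suitable basis, with diagonal
entries in `s`. The triangular shape is recorded by a height function on the index type. -/
theorem exists_basis_triangular {R : Type} [CommRing R] [IsDomain R] [IsPrincipalIdealRing R]
    (s : List R) : ∀ {M : Type} [AddCommGroup M] [Module R M] [Module.Free R M]
    [Module.Finite R M] (f : End R M), aeval f (s.map fun a => X - C a).prod = 0 →
    ∃ (ι : Type) (_ : Fintype ι) (b : Basis ι R M) (h : ι → ℕ),
      (∀ i j, b.repr (f (b j)) i ≠ 0 → i = j ∨ h i < h j) ∧ ∀ i, b.repr (f (b i)) i ∈ s := by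
  induction s with
  | nil =>
    intro M _ _ _ _ f hf
    have : Subsingleton M := by
      refine ⟨fun x y => ?_⟩
      have h1 : ∀ x : M, x = 0 := fun x => by
        simpa using congrArg (fun g : End R M => g x) hf
      rw [h1 x, h1 y]
    exact ⟨Empty, inferInstance, Basis.empty M, fun _ => 0, fun i => i.elim, fun i => i.elim⟩
  | cons a s ih =>
    intro M _ _ _ _ f hf
    -- On the kernel of `g` the map `f` is multiplication by `a`; on its range, again free over a
    -- PID, `f` is annihilated by the remaining factors.
    let g : End R M := f - algebraMap R (End R M) a
    have hg : ∀ x, g x = f x - a • x := fun x => by simp [g, Module.algebraMap_end_apply]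
    have hfg : ∀ x, g (f x) = f (g x) := fun x => by simp [hg]
    let f' : End R (LinearMap.range g) := f.restrict (by
      rintro _ ⟨x, rfl⟩
      exact ⟨f x, hfg x⟩)
    have hf' : aeval f' (s.map fun a => X - C a).prod = 0 := by
      ext ⟨_, x, rfl⟩
      have := Polynomial.comp_aeval_eq_aeval_comp (f := f') (g := f)
        (LinearMap.range g).subtype (fun _ => rfl) (s.map fun a => X - C a).prod ⟨g x, x, rfl⟩
      rw [Submodule.subtype_apply] at this
      rw [this]
      have h2 := congrArg (fun q : End R M => q x) hf
      rw [List.map_cons, List.prod_cons, mul_comm, map_mul] at h2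
      simpa [g] using h2
    obtain ⟨ι, hι, b, h, hb, hdiag⟩ := ih f' hf'
    obtain ⟨σ, hσ⟩ := g.rangeRestrict.exists_rightInverse_of_surjective g.range_rangeRestrict
    have hσ' : ∀ y : LinearMap.range g, g (σ y) = y := fun y =>
      congrArg Subtype.val (LinearMap.congr_fun hσ y)
    -- The range is projective, so `σ` splits `g` and the bases of kernel and range combine into a
    -- basis of `M`.
    let e : (LinearMap.ker g × LinearMap.range g) ≃ₗ[R] M :=
      { toFun := fun p => p.1 + σ p.2
        map_add' := fun p q => by simp; abel
        map_smul' := fun c p => by simp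
        invFun := fun x => (⟨x - σ (g.rangeRestrict x), by simp [hσ']⟩, g.rangeRestrict x)
        left_inv := fun p => by
          have h1 : g.rangeRestrict (p.1 + σ p.2) = p.2 := by
            apply Subtype.ext; simp [hσ']
          ext <;> simp [h1]
        right_inv := fun x => by simp }
    have he : ∀ x, (e.symm x).2 = g.rangeRestrict x := fun x => rfl
    let k := Free.chooseBasis R (LinearMap.ker g)
    let B : Basis (Free.ChooseBasisIndex R (LinearMap.ker g) ⊕ ι) R M := (k.prod b).map e
    have hB : ∀ x, B.repr x = (k.prod b).repr (e.symm x) := fun x => rfl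
    have hBl : ∀ i, f (B (Sum.inl i)) = a • B (Sum.inl i) := by
      intro i
      have h1 : B (Sum.inl i) = k i := by simp [B, e, Basis.prod_apply]
      have h2 : g (k i) = 0 := (k i).2
      rw [h1, ← sub_eq_zero, ← hg, h2]
    -- The range component of `f (σ y)` is `g (f (σ y)) = f (g (σ y)) = f y`.
    have hBr : ∀ i j, B.repr (f (B (Sum.inr j))) (Sum.inr i) = b.repr (f' (b j)) i := by
      intro i j
      have h1 : B (Sum.inr j) = σ (b j) := by simp [B, e, Basis.prod_apply]
      rw [hB, Basis.prod_repr_inr, he, h1]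
      congr 2
      apply Subtype.ext
      simp [hfg, hσ', f']
    -- The shift by `1` puts the kernel strictly below the range, which permits arbitrary kernel
    -- components in the range columns.
    refine ⟨_, inferInstance, B, Sum.elim (fun _ => 0) (fun i => h i + 1), ?_, ?_⟩
    · rintro i (j | j) hij
      · left
        by_contra hne
        simp [hBl, Ne.symm hne] at hij
      · rcases i with i | i
        · right; simp
        · rw [hBr] at hij
          rcases hb i j hij with rfl | hlt
          · exact Or.inl rfl
          · right; simpa using hlt
    · rintro (i | i)
      · simp [hBl]
      · rw [hBr]
        exact List.mem_cons_of_mem _ (hdiag i)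

end TriangularBasis

/-! ### Integer triangular form of the matrix -/

section IntegerMatrix

open Polynomial Matrix

/-- The characteristic polynomial of an integer matrix with rational complex eigenvalues is a
product of linear factors over `ℤ`. -/
theorem exists_charpoly_eq_prod {m : ℕ} (A : Matrix (Fin m) (Fin m) ℤ)
    (hrat : ∀ μ : ℂ, IsEigenvalueOf A μ → ∃ r : ℚ, μ = (r : ℂ)) :
    ∃ s : List ℤ, A.charpoly = (s.map fun a => X - C a).prod ∧
      ∀ a ∈ s, IsEigenvalueOf A (a : ℂ) := by
  let p : ℂ[X] := A.charpoly.map (Int.castRingHom ℂ)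
  have hmonic : p.Monic := A.charpoly_monic.map _
  have hp : p = (A.map (Int.cast : ℤ → ℂ)).charpoly := (A.charpoly_map (Int.castRingHom ℂ)).symm
  have heig : ∀ μ ∈ p.roots, IsEigenvalueOf A μ := by
    intro μ hμ
    rw [IsEigenvalueOf, Module.End.hasEigenvalue_iff_isRoot_charpoly, Matrix.charpoly_toLin', ← hp]
    exact isRoot_of_mem_roots hμ
  have hint : ∀ μ ∈ p.roots, ∃ a : ℤ, (a : ℂ) = μ := by
    intro μ hμ
    obtain ⟨r, rfl⟩ := hrat μ (heig μ hμ)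
    -- A rational root of a monic integer polynomial is an integer, as `ℤ` is integrally closed.
    have h1 : IsIntegral ℤ (algebraMap ℚ ℂ r) :=
      ⟨A.charpoly, A.charpoly_monic, by
        have := isRoot_of_mem_roots hμ
        rwa [IsRoot.def, eval_map] at this⟩
    rw [isIntegral_algebraMap_iff (algebraMap ℚ ℂ).injective] at h1
    obtain ⟨a, ha⟩ := IsIntegrallyClosed.isIntegral_iff.1 h1
    exact ⟨a, by rw [← ha]; simp⟩
  obtain ⟨s, hs⟩ : ∃ s : List ℤ, ((s.map (Int.cast : ℤ → ℂ) : List ℂ) : Multiset ℂ) = p.roots := by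
    have : p.roots.toList ∈ Set.range (List.map (Int.cast : ℤ → ℂ)) := by
      rw [Set.range_list_map]
      exact fun μ hμ => hint μ (Multiset.mem_toList.1 hμ)
    obtain ⟨s, hs⟩ := this
    exact ⟨s, by rw [hs, Multiset.coe_toList]⟩
  refine ⟨s, map_injective (Int.castRingHom ℂ) Int.cast_injective ?_, fun a ha => ?_⟩
  · change p = _
    rw [(IsAlgClosed.splits p).eq_prod_roots_of_monic hmonic, ← hs, Polynomial.map_list_prod]
    simp [Function.comp_def]
  · apply heig
    rw [← hs]
    exact List.mem_map_of_mem ha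

/-- A dilation matrix with rational eigenvalues is conjugate over `ℤ` to a triangular matrix whose
diagonal entries have absolute value at least two. -/
theorem exists_integer_triangularization {m : ℕ} (A : Matrix (Fin m) (Fin m) ℤ)
    (hA : IsDilationMatrix A)
    (hrat : ∀ μ : ℂ, IsEigenvalueOf A μ → ∃ r : ℚ, μ = (r : ℂ)) :
    ∃ (P P' C : Matrix (Fin m) (Fin m) ℤ) (h : Fin m → ℕ), P * P' = 1 ∧ P' * P = 1 ∧
      A = P * C * P' ∧ (∀ i j, C i j ≠ 0 → i = j ∨ h i < h j) ∧ ∀ i, 2 ≤ |C i i| := by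
  obtain ⟨s, hs, hseig⟩ := exists_charpoly_eq_prod A hrat
  have haev : aeval A.toLin' (s.map fun a => X - C a).prod = 0 := by
    rw [← hs, ← Matrix.charpoly_toLin', LinearMap.aeval_self_charpoly]
  obtain ⟨ι, _, b₀, h₀, hb₀, hd₀⟩ := exists_basis_triangular s A.toLin' haev
  let e : ι ≃ Fin m := b₀.indexEquiv (Pi.basisFun ℤ (Fin m))
  let b := b₀.reindex e
  let std := Pi.basisFun ℤ (Fin m)
  have hentry : ∀ i j, LinearMap.toMatrix b b A.toLin' i j =
      b₀.repr (A.toLin' (b₀ (e.symm j))) (e.symm i) := by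
    intro i j
    simp [LinearMap.toMatrix_apply, b]
  refine ⟨std.toMatrix b, b.toMatrix std, LinearMap.toMatrix b b A.toLin', h₀ ∘ e.symm,
    std.toMatrix_mul_toMatrix_flip b, b.toMatrix_mul_toMatrix_flip std, ?_, ?_, ?_⟩
  · rw [basis_toMatrix_mul_linearMap_toMatrix_mul_basis_toMatrix]
    simp [std, LinearMap.toMatrix_eq_toMatrix']
  · intro i j hij
    rw [hentry] at hij
    rcases hb₀ _ _ hij with h1 | h1
    · exact Or.inl (e.symm.injective h1)
    · exact Or.inr h1
  · intro i
    rw [hentry]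
    have h1 := hA _ (hseig _ (hd₀ (e.symm i)))
    rw [Complex.norm_intCast] at h1
    have : (1 : ℤ) < |b₀.repr (A.toLin' (b₀ (e.symm i))) (e.symm i)| := by exact_mod_cast h1
    omega

/-! ### Rescaled boxes as digit sets -/

/-- The box of integer vectors `k` with `0 ≤ k i < |c i|`. -/
def digitBox {ι : Type*} (c : ι → ℤ) : Set (ι → ℤ) := {k | ∀ i, 0 ≤ k i ∧ k i < |c i|}

theorem exists_mul_add_mul_eq {c r : ℤ} (hc : c ≠ 0) (hrc : IsCoprime r c) (y : ℤ) :
    ∃ z k : ℤ, (0 ≤ k ∧ k < |c|) ∧ c * z + r * k = y := by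
  obtain ⟨u, v, huv⟩ := hrc
  refine ⟨v * y + r * ((u * y) / c), (u * y) % c, ⟨Int.emod_nonneg _ hc, Int.emod_lt_abs _ hc⟩, ?_⟩
  have := Int.emod_add_mul_ediv (u * y) c
  linear_combination y * huv + r * this

theorem mulVec_apply_eq_add_sum {ι R : Type*} [Fintype ι] [DecidableEq ι] [CommRing R]
    (M : Matrix ι ι R) (x : ι → R) (i : ι) :
    (M *ᵥ x) i = M i i * x i + ∑ j ∈ Finset.univ.erase i, M i j * x j :=
  (Finset.add_sum_erase _ (fun j => M i j * x j) (Finset.mem_univ i)).symm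

/-- Back substitution: row `i` involves, besides `w i`, only entries of `w` at greater height, so
the rows are solved from the top height down, each by Bézout with remainder. This says that the
scaled box meets every coset. -/
theorem exists_mulVec_add_mul_eq {ι : Type*} [Fintype ι] [DecidableEq ι] {M : Matrix ι ι ℤ}
    {h : ι → ℕ} (htri : ∀ i j, M i j ≠ 0 → i = j ∨ h i < h j) (hdiag : ∀ i, M i i ≠ 0)
    {r : ι → ℤ} (hr : ∀ i, IsCoprime (r i) (M i i)) (x : ι → ℤ) :
    ∃ w, ∃ k ∈ digitBox fun i => M i i, M *ᵥ w + r * k = x := by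
  obtain ⟨N, hN⟩ := Finite.bddAbove_range h
  have hN' : ∀ i, h i ≤ N := fun i => hN ⟨i, rfl⟩
  have key : ∀ n : ℕ, ∃ w, ∃ k ∈ digitBox fun i => M i i,
      ∀ i, N + 1 ≤ h i + n → (M *ᵥ w) i + r i * k i = x i := by
    intro n
    induction n with
    | zero =>
      -- No row has height above `N`, so there is nothing to solve yet.
      refine ⟨0, 0, fun i => ⟨le_rfl, abs_pos.2 (hdiag i)⟩, fun i hi => ?_⟩
      have := hN' i
      omega
    | succ n ih =>
      obtain ⟨w, k, hk, hwk⟩ := ih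
      choose z l hl hzl using fun i => exists_mul_add_mul_eq (hdiag i) (hr i)
        (x i - ∑ j ∈ Finset.univ.erase i, M i j * w j)
      refine ⟨fun i => if N + 1 ≤ h i + n then w i else z i,
        fun i => if N + 1 ≤ h i + n then k i else l i, fun i => ?_, fun i hi => ?_⟩
      · dsimp only
        split_ifs
        exacts [hk i, hl i]
      · rw [mulVec_apply_eq_add_sum]
        have hsum : ∑ j ∈ Finset.univ.erase i, M i j * (if N + 1 ≤ h j + n then w j else z j) =
            ∑ j ∈ Finset.univ.erase i, M i j * w j := by
          refine Finset.sum_congr rfl fun j hj => ?_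
          by_cases hij : M i j = 0
          · simp [hij]
          · have := (htri i j hij).resolve_left (Finset.ne_of_mem_erase hj).symm
            rw [if_pos (by omega)]
        rw [hsum]
        dsimp only
        split_ifs with hi'
        · rw [← hwk i hi', mulVec_apply_eq_add_sum]
        · linear_combination hzl i
  obtain ⟨w, k, hk, hwk⟩ := key (N + 1)
  exact ⟨w, k, hk, funext fun i => hwk i (by omega)⟩

/-- From the greatest height down, the off-diagonal part of row `i` vanishes, so `M i i` divides `r
i * (k i - l i)`, hence `k i - l i` by coprimality; the box is too small for a nonzero multiple.
Thus scaled digits are pairwise incongruent. -/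
theorem eq_of_mul_sub_eq_mulVec {ι : Type*} [Fintype ι] [DecidableEq ι] {M : Matrix ι ι ℤ}
    {h : ι → ℕ} (htri : ∀ i j, M i j ≠ 0 → i = j ∨ h i < h j) (hdiag : ∀ i, M i i ≠ 0)
    {r : ι → ℤ} (hr : ∀ i, IsCoprime (r i) (M i i)) {k l w : ι → ℤ}
    (hk : k ∈ digitBox fun i => M i i) (hl : l ∈ digitBox fun i => M i i)
    (hw : r * (k - l) = M *ᵥ w) : k = l := by
  obtain ⟨N, hN⟩ := Finite.bddAbove_range h
  have hN' : ∀ i, h i ≤ N := fun i => hN ⟨i, rfl⟩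
  have key : ∀ i, w i = 0 ∧ k i = l i := by
    intro i
    induction i using (measure fun i => N - h i).wf.induction with
    | h i ih =>
      have hsum : ∑ j ∈ Finset.univ.erase i, M i j * w j = 0 := by
        refine Finset.sum_eq_zero fun j hj => ?_
        by_cases hij : M i j = 0
        · simp [hij]
        · have := (htri i j hij).resolve_left (Finset.ne_of_mem_erase hj).symm
          have hj' := hN' j
          rw [(ih j (show N - h j < N - h i by omega)).1, mul_zero]
      have hrow := congrFun hw i
      rw [mulVec_apply_eq_add_sum, hsum, add_zero, Pi.mul_apply, Pi.sub_apply] at hrow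
      have hdvd : M i i ∣ k i - l i := (hr i).symm.dvd_of_dvd_mul_left ⟨w i, hrow⟩
      have hkl : k i - l i = 0 := by
        refine Int.eq_zero_of_abs_lt_dvd ((abs_dvd _ _).2 hdvd) ?_
        have h1 := hk i
        have h2 := hl i
        rw [abs_lt]
        constructor <;> linarith [h1.1, h1.2, h2.1, h2.2]
      rw [hkl, mul_zero] at hrow
      exact ⟨(mul_eq_zero.1 hrow.symm).resolve_left (hdiag i), sub_eq_zero.1 hkl⟩
  exact funext fun i => (key i).2

theorem isDigitSet_image_digitBox {m : ℕ} {A P P' M : Matrix (Fin m) (Fin m) ℤ}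
    (hPP' : P * P' = 1) (hP'P : P' * P = 1) (hA : A = P * M * P') {h : Fin m → ℕ}
    (htri : ∀ i j, M i j ≠ 0 → i = j ∨ h i < h j) (hdiag : ∀ i, M i i ≠ 0)
    {r : Fin m → ℤ} (hr : ∀ i, IsCoprime (r i) (M i i)) :
    IsDigitSet A ((fun k => P *ᵥ (r * k)) '' digitBox fun i => M i i) := by
  refine ⟨fun _ _ => Set.mem_univ _, ?_, ?_⟩
  · rintro _ ⟨k, hk, rfl⟩ _ ⟨l, hl, rfl⟩ hkl
    rw [Submodule.mkQ_apply, Submodule.mkQ_apply, Submodule.Quotient.eq] at hkl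
    obtain ⟨z, hz⟩ := hkl
    rw [Matrix.mulVecLin_apply, ← Matrix.mulVec_sub, ← mul_sub] at hz
    have h1 := congrArg (P' *ᵥ ·) hz
    simp only [hA, Matrix.mulVec_mulVec, ← Matrix.mul_assoc, hP'P, Matrix.one_mul,
      Matrix.one_mulVec] at h1
    rw [← Matrix.mulVec_mulVec] at h1
    rw [eq_of_mul_sub_eq_mulVec htri hdiag hr hk hl h1.symm]
  · intro q _
    obtain ⟨x, rfl⟩ := Submodule.mkQ_surjective _ q
    obtain ⟨w, k, hk, hwk⟩ := exists_mulVec_add_mul_eq htri hdiag hr (P' *ᵥ x)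
    refine ⟨_, ⟨k, hk, rfl⟩, ?_⟩
    rw [Submodule.mkQ_apply, Submodule.mkQ_apply, eq_comm, Submodule.Quotient.eq]
    refine ⟨P *ᵥ w, ?_⟩
    have h1 : x = P *ᵥ (P' *ᵥ x) := by rw [Matrix.mulVec_mulVec, hPP', Matrix.one_mulVec]
    rw [h1, ← hwk, Matrix.mulVec_add, add_sub_cancel_right, Matrix.mulVecLin_apply, hA,
      Matrix.mulVec_mulVec, Matrix.mul_assoc, hP'P, Matrix.mul_one, Matrix.mulVec_mulVec]

end IntegerMatrix

/-! ### Connected attractor for a nearly diagonal matrix -/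

section ConnectedBoxAttractor

open Matrix Metric Set Bornology
open scoped Pointwise

/-- Truncated rounding: a real number of size at most `n - 1/4` is within `3/4` of an integer of
size at most `n - 1`. -/
theorem exists_int_abs_sub_le {n : ℤ} {y : ℝ} (hy : |y| ≤ n - 1 / 4) :
    ∃ δ : ℤ, |δ| ≤ n - 1 ∧ |y - δ| ≤ 3 / 4 := by
  have hround := abs_le.1 (abs_sub_round y)
  have hy' := abs_le.1 hy
  by_cases h1 : |round y| ≤ n - 1
  · exact ⟨round y, h1, (abs_sub_round y).trans (by norm_num)⟩
  · have hn : 0 ≤ n - 1 := by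
      have : (0 : ℝ) < n := by linarith [abs_nonneg y]
      have : 0 < n := by exact_mod_cast this
      omega
    rw [not_le, lt_abs] at h1
    rcases h1 with h1 | h1
    · have h2 : (n : ℝ) ≤ round y := by exact_mod_cast (by omega : n ≤ round y)
      refine ⟨n - 1, (abs_of_nonneg hn).le, abs_le.2 ?_⟩
      push_cast
      constructor <;> linarith
    · have h2 : (n : ℝ) ≤ -round y := by exact_mod_cast (by omega : n ≤ -round y)
      refine ⟨-(n - 1), by rw [abs_neg, abs_of_nonneg hn], abs_le.2 ?_⟩
      push_cast
      constructor <;> linarith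

variable {ι : Type*} [Fintype ι] [DecidableEq ι] {B : Matrix ι ι ℝ} {c : ι → ℤ} {h : ι → ℕ}

theorem abs_sum_erase_le (hoff : ∀ i, ∑ j ∈ Finset.univ.erase i, |B i j| ≤ 1 / 4) {x : ι → ℝ}
    {a : ℝ} (ha : 0 ≤ a) (hx : ∀ i, |x i| ≤ a) (i : ι) :
    |∑ j ∈ Finset.univ.erase i, B i j * x j| ≤ a / 4 :=
  calc |∑ j ∈ Finset.univ.erase i, B i j * x j|
      ≤ ∑ j ∈ Finset.univ.erase i, |B i j * x j| := Finset.abs_sum_le_sum_abs _ _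
    _ ≤ ∑ j ∈ Finset.univ.erase i, |B i j| * a := by
      refine Finset.sum_le_sum fun j _ => ?_
      rw [abs_mul]
      gcongr
      exact hx j
    _ = (∑ j ∈ Finset.univ.erase i, |B i j|) * a := (Finset.sum_mul _ _ _).symm
    _ ≤ 1 / 4 * a := by gcongr; exact hoff i
    _ = a / 4 := by ring

theorem norm_le_norm_mulVec (hdiag : ∀ i, B i i = c i) (hc : ∀ i, 2 ≤ |c i|)
    (hoff : ∀ i, ∑ j ∈ Finset.univ.erase i, |B i j| ≤ 1 / 4) (x : ι → ℝ) :
    7 / 4 * ‖x‖ ≤ ‖B *ᵥ x‖ := by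
  -- The diagonal expands each coordinate by at least `2` and the off-diagonal part costs at most
  -- `‖x‖ / 4`, leaving `7 / 4`.
  have key : ‖x‖ ≤ (‖B *ᵥ x‖ + ‖x‖ / 4) / 2 := by
    rw [pi_norm_le_iff_of_nonneg (by positivity)]
    intro i
    have h1 := abs_sum_erase_le hoff (norm_nonneg x) (fun i => norm_le_pi_norm x i) i
    have h2 : |(B *ᵥ x) i| ≤ ‖B *ᵥ x‖ := norm_le_pi_norm (B *ᵥ x) i
    have h3 : (c i : ℝ) * x i = (B *ᵥ x) i - ∑ j ∈ Finset.univ.erase i, B i j * x j := by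
      rw [mulVec_apply_eq_add_sum, hdiag]; ring
    have h4 : 2 * |x i| ≤ |(c i : ℝ) * x i| := by
      rw [abs_mul]
      gcongr
      exact_mod_cast hc i
    rw [h3] at h4
    have h5 := abs_sub ((B *ᵥ x) i) (∑ j ∈ Finset.univ.erase i, B i j * x j)
    rw [Real.norm_eq_abs]
    linarith
  linarith

theorem isUnit_det_of_norm_le (hB : ∀ x : ι → ℝ, 7 / 4 * ‖x‖ ≤ ‖B *ᵥ x‖) : IsUnit B.det := by
  rw [← Matrix.isUnit_iff_isUnit_det, ← Matrix.mulVec_injective_iff_isUnit]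
  intro x y hxy
  have h1 := hB (x - y)
  rw [Matrix.mulVec_sub, show B *ᵥ x = B *ᵥ y from hxy, sub_self, norm_zero] at h1
  have h2 := norm_nonneg (x - y)
  exact sub_eq_zero.1 (norm_eq_zero.1 (by linarith))

/-- Vectors with one entry `±1` in position `i`, entries of size at most `3/4` at smaller heights
and zero entries elsewhere. -/
def unitLikeVectors (h : ι → ℕ) : Set (ι → ℝ) :=
  {v | ∃ i, |v i| = 1 ∧ ∀ j, j ≠ i → |v j| ≤ 3 / 4 ∧ (v j ≠ 0 → h j < h i)}

/-- Row `i` of `B v` is exactly `± c i`, since `v` vanishes at greater heights; subtracting `±(|c i|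
- 1)` leaves `±1`. At smaller heights the entry is at most `(3/4) |c j| + 1/4 ≤ |c j| - 1/4`,
precisely because `|c j| ≥ 2`, so truncated rounding applies. The remaining entries stay `0`. -/
theorem exists_sub_mem_unitLikeVectors (hdiag : ∀ i, B i i = c i) (hc : ∀ i, 2 ≤ |c i|)
    (htri : ∀ i j, B i j ≠ 0 → i = j ∨ h i < h j)
    (hoff : ∀ i, ∑ j ∈ Finset.univ.erase i, |B i j| ≤ 1 / 4) {v : ι → ℝ}
    (hv : v ∈ unitLikeVectors h) :
    ∃ δ : ι → ℤ, (∀ i, |δ i| ≤ |c i| - 1) ∧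
      (B *ᵥ v - fun i => (δ i : ℝ)) ∈ unitLikeVectors h := by
  obtain ⟨i, hvi, hvj⟩ := hv
  have hv1 : ∀ j, |v j| ≤ 1 := by
    intro j
    by_cases hj : j = i
    · rw [hj, hvi]
    · exact (hvj j hj).1.trans (by norm_num)
  have hzero : ∀ j, ¬ h j < h i → ∑ l ∈ Finset.univ.erase j, B j l * v l = 0 := by
    intro j hj
    refine Finset.sum_eq_zero fun l hl => ?_
    by_contra hne
    have h1 := (htri j l (left_ne_zero_of_mul hne)).resolve_left (Finset.ne_of_mem_erase hl).symm
    by_cases hli : l = i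
    · exact hj (hli ▸ h1)
    · exact hj (h1.trans ((hvj l hli).2 (right_ne_zero_of_mul hne)))
  have hpos : ∃ δ : ℤ, |δ| ≤ |c i| - 1 ∧ |(B *ᵥ v) i - δ| = 1 := by
    rw [mulVec_apply_eq_add_sum, hzero i (lt_irrefl _), add_zero, hdiag]
    have h2 := hc i
    have hsgn : ∃ δ : ℤ, |δ| ≤ |c i| - 1 ∧ |(c i : ℝ) - δ| = 1 := by
      rcases le_abs.1 (hc i) with hci | hci
      · refine ⟨c i - 1, ?_, by push_cast; norm_num⟩
        rw [abs_of_nonneg (by omega : 0 ≤ c i), abs_of_nonneg (by omega)]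
      · refine ⟨c i + 1, ?_, by push_cast; norm_num⟩
        rw [abs_of_nonpos (by omega : c i ≤ 0), abs_of_nonpos (by omega)]
        omega
    obtain ⟨δ, hδ, hδ1⟩ := hsgn
    rcases (abs_eq zero_le_one).1 hvi with hvi | hvi
    · exact ⟨δ, hδ, by rw [hvi, mul_one, hδ1]⟩
    · refine ⟨-δ, by rwa [abs_neg], ?_⟩
      rw [hvi, show (c i : ℝ) * -1 - ((-δ : ℤ) : ℝ) = -(c i - δ) by push_cast; ring, abs_neg, hδ1]
  have hother : ∀ j, j ≠ i → ∃ δ : ℤ, |δ| ≤ |c j| - 1 ∧ |(B *ᵥ v) j - δ| ≤ 3 / 4 ∧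
      ((B *ᵥ v) j - δ ≠ 0 → h j < h i) := by
    intro j hj
    have hcj : (2 : ℝ) ≤ |(c j : ℝ)| := by exact_mod_cast hc j
    by_cases hji : h j < h i
    · have hle : |(B *ᵥ v) j| ≤ ((|c j| : ℤ) : ℝ) - 1 / 4 := by
        rw [mulVec_apply_eq_add_sum, hdiag, Int.cast_abs]
        have h1 := abs_sum_erase_le hoff zero_le_one hv1 j
        have h2 : |(c j : ℝ) * v j| ≤ |(c j : ℝ)| * (3 / 4) := by
          rw [abs_mul]
          gcongr
          exact (hvj j hj).1
        have h3 := abs_add_le ((c j : ℝ) * v j) (∑ l ∈ Finset.univ.erase j, B j l * v l)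
        linarith
      obtain ⟨δ, h1, h2⟩ := exists_int_abs_sub_le hle
      exact ⟨δ, h1, h2, fun _ => hji⟩
    · have hvj0 : v j = 0 := by
        by_contra hne
        exact hji ((hvj j hj).2 hne)
      have h0 : (B *ᵥ v) j = 0 := by
        rw [mulVec_apply_eq_add_sum, hzero j hji, hvj0, mul_zero, add_zero]
      refine ⟨0, ?_, ?_, ?_⟩
      · have := hc j
        rw [abs_zero]
        omega
      · rw [h0]; norm_num
      · intro hne
        simp [h0] at hne
  have hall : ∀ j, ∃ δ : ℤ, |δ| ≤ |c j| - 1 ∧ (j = i → |(B *ᵥ v) j - δ| = 1) ∧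
      (j ≠ i → |(B *ᵥ v) j - δ| ≤ 3 / 4 ∧ ((B *ᵥ v) j - δ ≠ 0 → h j < h i)) := by
    intro j
    by_cases hj : j = i
    · subst hj
      obtain ⟨δ, h1, h2⟩ := hpos
      exact ⟨δ, h1, fun _ => h2, fun hne => absurd rfl hne⟩
    · obtain ⟨δ, h1, h2⟩ := hother j hj
      exact ⟨δ, h1, fun he => absurd he hj, fun _ => h2⟩
  choose δ h1 h2 h3 using hall
  exact ⟨δ, h1, i, h2 i rfl, fun j hj => h3 j hj⟩

/-- For a nearly diagonal triangular real matrix `B` with integer diagonal `c`, the system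
`x ↦ B⁻¹ (x + d)`, `d ∈ digitBox c`, has a unique attractor, and it is connected. -/
theorem exists_connected_attractor_digitBox (hdiag : ∀ i, B i i = c i) (hc : ∀ i, 2 ≤ |c i|)
    (htri : ∀ i j, B i j ≠ 0 → i = j ∨ h i < h j)
    (hoff : ∀ i, ∑ j ∈ Finset.univ.erase i, |B i j| ≤ 1 / 4) :
    ∃ T : Set (ι → ℝ), (T.Nonempty ∧ IsCompact T ∧
        T = ⋃ d ∈ digitBox c, (fun x => B⁻¹ *ᵥ (x + fun i => (d i : ℝ))) '' T) ∧
      (∀ K : Set (ι → ℝ), K.Nonempty → IsCompact K →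
        K = ⋃ d ∈ digitBox c, (fun x => B⁻¹ *ᵥ (x + fun i => (d i : ℝ))) '' K → K = T) ∧
      IsConnected T := by
  have hexp := norm_le_norm_mulVec hdiag hc hoff
  have hunit := isUnit_det_of_norm_le hexp
  have hBinv : ∀ x, B *ᵥ (B⁻¹ *ᵥ x) = x := fun x => by
    rw [Matrix.mulVec_mulVec, Matrix.mul_nonsing_inv _ hunit, Matrix.one_mulVec]
  have hinvB : ∀ x, B⁻¹ *ᵥ (B *ᵥ x) = x := fun x => by
    rw [Matrix.mulVec_mulVec, Matrix.nonsing_inv_mul _ hunit, Matrix.one_mulVec]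
  have hcontr : ∀ x y, dist (B⁻¹ *ᵥ x) (B⁻¹ *ᵥ y) ≤ 4 / 7 * dist x y := by
    intro x y
    have := hexp (B⁻¹ *ᵥ (x - y))
    rw [hBinv] at this
    rw [dist_eq_norm, dist_eq_norm, ← Matrix.mulVec_sub]
    linarith
  let f : (ι → ℤ) → (ι → ℝ) → (ι → ℝ) := fun d x => B⁻¹ *ᵥ (x + fun i => (d i : ℝ))
  have hf : ∀ d ∈ digitBox c, ∀ x y, dist (f d x) (f d y) ≤ 4 / 7 * dist x y := by
    intro d _ x y
    simpa [f] using hcontr (x + fun i => (d i : ℝ)) (y + fun i => (d i : ℝ))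
  have hinj : ∀ d ∈ digitBox c, Function.Injective (f d) := by
    intro d _ x y hxy
    have := congrArg (B *ᵥ ·) hxy
    simpa [f, hBinv] using this
  have hfin : (digitBox c).Finite := by
    refine (Set.finite_Icc (0 : ι → ℤ) fun i => |c i|).subset fun d hd => ?_
    exact ⟨fun i => (hd i).1, fun i => (hd i).2.le⟩
  have h0mem : (0 : ι → ℤ) ∈ digitBox c := fun i =>
    ⟨le_rfl, show (0 : ℤ) < |c i| by have := hc i; omega⟩
  have hρ0 : (0 : ℝ) ≤ 4 / 7 := by norm_num
  have hρ1 : (4 / 7 : ℝ) < 1 := by norm_num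
  obtain ⟨T, hTne, hTc, hTe⟩ := exists_attractor hfin ⟨0, h0mem⟩ hρ0 hρ1 hf hinj
  refine ⟨T, ⟨hTne, hTc, hTe⟩, fun K hKne hK hKe =>
    attractor_unique hρ0 hρ1 hf hKne hK hKe hTne hTc hTe, hTne, ?_⟩
  have hmap : ∀ d ∈ digitBox c, ∀ x ∈ T, f d x ∈ T := by
    intro d hd x hx
    rw [hTe]
    exact mem_biUnion hd (mem_image_of_mem _ hx)
  have hunitLike : unitLikeVectors h ⊆ T - T := by
    have hcpt : IsCompact (T - T) := by
      rw [← Set.image2_sub, ← Set.image_prod]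
      exact (hTc.prod hTc).image continuous_sub
    refine subset_of_infDist_le_mul_infDist ?_ hcpt.isClosed (hTne.sub hTne) hρ0 hρ1
      fun v hv => ?_
    · refine isBounded_closedBall (x := (0 : ι → ℝ)) (r := 1) |>.subset ?_
      rintro v ⟨i, hi, hj⟩
      rw [mem_closedBall_zero_iff, pi_norm_le_iff_of_nonneg zero_le_one]
      intro j
      by_cases hji : j = i
      · rw [hji, Real.norm_eq_abs, hi]
      · exact (hj j hji).1.trans (by norm_num)
    · obtain ⟨δ, hδ, hmem⟩ := exists_sub_mem_unitLikeVectors hdiag hc htri hoff hv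
      refine ⟨_, hmem, ?_⟩
      -- This is the inverse of the step `v ↦ B v - δ`. It preserves `T - T` because `δ` is the
      -- difference of its positive and negative parts, both of which are digits.
      let g : (ι → ℝ) → (ι → ℝ) := fun y => B⁻¹ *ᵥ (y + fun i => (δ i : ℝ))
      have hgv : g (B *ᵥ v - fun i => (δ i : ℝ)) = v := by
        simp only [g, sub_add_cancel, hinvB]
      have hgS : MapsTo g (T - T) (T - T) := by
        rintro _ ⟨a, ha, b, hb, rfl⟩
        refine ⟨f (fun i => max (δ i) 0) a, hmap _ (fun i => ?_) a ha,
          f (fun i => max (-δ i) 0) b, hmap _ (fun i => ?_) b hb, ?_⟩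
        · have h1 := abs_le.1 (hδ i)
          have := hc i
          constructor <;> omega
        · have h1 := abs_le.1 (hδ i)
          have := hc i
          constructor <;> omega
        · simp only [f, g, ← Matrix.mulVec_sub]
          congr 1
          funext i
          have hmax : ((max (δ i) 0 : ℤ) : ℝ) - ((max (-δ i) 0 : ℤ) : ℝ) = δ i := by
            exact_mod_cast (by omega : max (δ i) 0 - max (-δ i) 0 = δ i)
          simp only [Pi.sub_apply, Pi.add_apply]
          linear_combination hmax
      have hle := infDist_le_mul_infDist_of_mapsTo (hTne.sub hTne) hρ0 (g := g)
        (fun x y => by simpa [g] using hcontr (x + fun i => (δ i : ℝ)) (y + fun i => (δ i : ℝ)))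
        hgS (B *ᵥ v - fun i => (δ i : ℝ))
      rwa [hgv] at hle
  refine attractor_isPreconnected hρ0 hρ1 hf hTc hTe fun p hp hex => ?_
  -- Every digit descends to `0` inside the box by lowering one positive coordinate by `1` at a
  -- time.
  have hiff : ∀ n : ℕ, ∀ d ∈ digitBox c, ∑ i, d i = n → (p d ↔ p 0) := by
    intro n
    induction n with
    | zero =>
      intro d hd hsum
      have : d = 0 := by
        funext i
        exact (Finset.sum_eq_zero_iff_of_nonneg fun i _ => (hd i).1).1 (by simpa using hsum) i
          (Finset.mem_univ i)
      rw [this]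
    | succ n ih =>
      intro d hd hsum
      obtain ⟨i, hi⟩ : ∃ i, 0 < d i := by
        by_contra! hno
        have : ∑ i, d i ≤ 0 := Finset.sum_nonpos fun i _ => hno i
        push_cast at hsum
        omega
      have hd' : d - Pi.single i 1 ∈ digitBox c := by
        intro j
        have := hd j
        by_cases hji : j = i
        · subst hji
          simp only [Pi.sub_apply, Pi.single_eq_same]
          omega
        · simpa [hji] using this
      have hsum' : ∑ j, (d - Pi.single i 1 : ι → ℤ) j = n := by
        simp [Finset.sum_sub_distrib, hsum]
      have hev : (Pi.single i 1 : ι → ℝ) ∈ T - T := hunitLike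
        ⟨i, by simp, fun j hj => by simp [hj]; norm_num⟩
      obtain ⟨a, ha, b, hb, hab⟩ := hev
      -- From `a - b = e i` follows `b + d = a + (d - e i)`: a common point of the two pieces.
      have heq : f d b = f (d - Pi.single i 1) a := by
        simp only [f]
        congr 1
        funext j
        have h1 := congrFun hab j
        by_cases hji : j = i
        · subst hji
          simp at h1 ⊢
          linarith
        · simp [hji] at h1 ⊢
          linarith
      rw [← ih _ hd' hsum']
      constructor
      · exact hp d hd _ hd' ⟨f d b, ⟨b, hb, rfl⟩, ⟨a, ha, heq.symm⟩⟩
      · exact hp _ hd' d hd ⟨f d b, ⟨a, ha, heq.symm⟩, ⟨b, hb, rfl⟩⟩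
  have hiff' : ∀ d ∈ digitBox c, (p d ↔ p 0) := by
    intro d hd
    have hnn : 0 ≤ ∑ i, d i := Finset.sum_nonneg fun i _ => (hd i).1
    exact hiff (∑ i, d i).toNat d hd (Int.toNat_of_nonneg hnn).symm
  obtain ⟨d, hd, hpd⟩ := hex
  exact fun e he => (hiff' e he).2 ((hiff' d hd).1 hpd)

end ConnectedBoxAttractor

/-! ### Diagonal rescaling and change of coordinates -/

section Rescaling

open Matrix

/-- Rescaling factors that make the off-diagonal part of a triangular integer matrix small while
staying coprime to its diagonal. -/
theorem exists_rescaling {ι : Type*} [Fintype ι] [DecidableEq ι] {M : Matrix ι ι ℤ} {h : ι → ℕ}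
    (htri : ∀ i j, M i j ≠ 0 → i = j ∨ h i < h j) (hdiag : ∀ i, M i i ≠ 0) :
    ∃ r : ι → ℤ, (∀ i, 0 < r i) ∧ (∀ i, IsCoprime (r i) (M i i)) ∧
      ∀ i, ∑ j ∈ Finset.univ.erase i, |(M i j : ℝ) * r j / r i| ≤ 1 / 4 := by
  obtain ⟨N, hN⟩ := Finite.bddAbove_range h
  have hN' : ∀ i, h i ≤ N := fun i => hN ⟨i, rfl⟩
  let S : ℤ := ∑ i, ∑ j, |M i j|
  let Δ : ℤ := ∏ i, M i i
  -- `R` is congruent to `1` modulo every diagonal entry, hence coprime to it, and it is at least `4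
  -- * S`. With `r i = R ^ (N - h i)`, each nonzero off-diagonal entry gains a factor at most `1 /
  -- R`.
  let R : ℤ := 1 + 4 * S * |Δ|
  have hS : 0 ≤ S := Finset.sum_nonneg fun i _ => Finset.sum_nonneg fun j _ => abs_nonneg _
  have hΔ : 1 ≤ |Δ| := Int.one_le_abs (Finset.prod_ne_zero_iff.2 fun i _ => hdiag i)
  have hR1 : 1 ≤ R := by
    have : 0 ≤ 4 * S * |Δ| := by positivity
    linarith
  have hR : 4 * S ≤ R := by
    have : 4 * S * 1 ≤ 4 * S * |Δ| := by gcongr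
    linarith
  have hcop : ∀ i, IsCoprime R (M i i) := by
    intro i
    obtain ⟨q, hq⟩ : M i i ∣ |Δ| := (dvd_abs _ _).2 (Finset.dvd_prod_of_mem _ (Finset.mem_univ i))
    exact ⟨1, -(4 * S * q), by simp only [R, hq]; ring⟩
  refine ⟨fun i => R ^ (N - h i), fun i => by positivity, fun i => (hcop i).pow_left, fun i => ?_⟩
  have hRpos : (0 : ℝ) < R := by exact_mod_cast (by omega : 0 < R)
  have hR1' : (1 : ℝ) ≤ R := by exact_mod_cast hR1
  have hterm : ∀ j ∈ Finset.univ.erase i,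
      |(M i j : ℝ) * ((R ^ (N - h j) : ℤ) : ℝ) / ((R ^ (N - h i) : ℤ) : ℝ)| ≤ |(M i j : ℝ)| / R := by
    intro j hj
    by_cases hij : M i j = 0
    · simp [hij]
    · have hlt := (htri i j hij).resolve_left (Finset.ne_of_mem_erase hj).symm
      have hj' := hN' j
      rw [abs_div, abs_mul, div_le_div_iff₀ (by positivity) hRpos, mul_assoc]
      gcongr
      push_cast
      rw [abs_of_pos (by positivity), abs_of_pos (by positivity), ← pow_succ]
      exact pow_le_pow_right₀ hR1' (by omega)
  refine (Finset.sum_le_sum hterm).trans ?_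
  rw [← Finset.sum_div, div_le_iff₀ hRpos]
  have hrow : ∑ j ∈ Finset.univ.erase i, |M i j| ≤ S :=
    (Finset.sum_le_sum_of_subset_of_nonneg (Finset.erase_subset _ _)
      fun _ _ _ => abs_nonneg _).trans
      (Finset.single_le_sum (f := fun i => ∑ j, |M i j|)
        (fun i _ => Finset.sum_nonneg fun j _ => abs_nonneg _) (Finset.mem_univ i))
  have hrow' : ∑ j ∈ Finset.univ.erase i, |(M i j : ℝ)| ≤ S := by exact_mod_cast hrow
  have hR' : 4 * (S : ℝ) ≤ R := by exact_mod_cast hR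
  linarith

/-- Transport of attractors along a change of coordinates `Q` that conjugates the systems. -/
theorem isAttractor_image_iff {m : ℕ} {A : Matrix (Fin m) (Fin m) ℤ} {κ : Type*} {s : Set κ}
    {φ : κ → Fin m → ℤ} {f : κ → (Fin m → ℝ) → (Fin m → ℝ)} (Q : (Fin m → ℝ) ≃ₜ (Fin m → ℝ))
    (hQ : ∀ k x, digitMap A (φ k) (Q x) = Q (f k x)) (K : Set (Fin m → ℝ)) :
    IsAttractor A (φ '' s) (Q '' K) ↔ K.Nonempty ∧ IsCompact K ∧ K = ⋃ k ∈ s, f k '' K := by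
  have hunion : ⋃ d ∈ φ '' s, digitMap A d '' (Q '' K) = Q '' ⋃ k ∈ s, f k '' K := by
    simp only [Set.biUnion_image, Set.image_iUnion, Set.image_image, hQ]
  constructor
  · rintro ⟨h1, h2, h3⟩
    rw [hunion] at h3
    exact ⟨Set.image_nonempty.1 h1, Q.isCompact_image.1 h2, Q.injective.image_injective h3⟩
  · rintro ⟨h1, h2, h3⟩
    exact ⟨h1.image _, Q.isCompact_image.2 h2, by rw [hunion, ← h3]⟩

/-- The homeomorphism of `ℝ^m` given by an invertible matrix. -/
def mulVecHomeomorph {m : ℕ} (Q Q' : Matrix (Fin m) (Fin m) ℝ) (hQQ' : Q * Q' = 1)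
    (hQ'Q : Q' * Q = 1) : (Fin m → ℝ) ≃ₜ (Fin m → ℝ) where
  toFun x := Q *ᵥ x
  invFun x := Q' *ᵥ x
  left_inv x := by simp only [Matrix.mulVec_mulVec, hQ'Q, Matrix.one_mulVec]
  right_inv x := by simp only [Matrix.mulVec_mulVec, hQQ', Matrix.one_mulVec]
  continuous_toFun := by fun_prop
  continuous_invFun := by fun_prop

theorem digitMap_mulVec {m : ℕ} {A : Matrix (Fin m) (Fin m) ℤ} {B Q Q' : Matrix (Fin m) (Fin m) ℝ}
    (hQQ' : Q * Q' = 1) (hQ'Q : Q' * Q = 1) (hB : IsUnit B.det)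
    (hA : A.map (Int.cast : ℤ → ℝ) = Q * B * Q') {d : Fin m → ℤ} {y : Fin m → ℝ}
    (hd : (fun i => (d i : ℝ)) = Q *ᵥ y) (x : Fin m → ℝ) :
    digitMap A d (Q *ᵥ x) = Q *ᵥ (B⁻¹ *ᵥ (x + y)) := by
  have hinv : (A.map (Int.cast : ℤ → ℝ))⁻¹ = Q * B⁻¹ * Q' := by
    apply Matrix.inv_eq_right_inv
    calc A.map (Int.cast : ℤ → ℝ) * (Q * B⁻¹ * Q') = Q * (B * (Q' * Q) * B⁻¹) * Q' := by
          rw [hA]; simp only [Matrix.mul_assoc]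
      _ = 1 := by rw [hQ'Q, Matrix.mul_one, Matrix.mul_nonsing_inv _ hB, Matrix.mul_one, hQQ']
  rw [digitMap, hinv, hd, ← Matrix.mulVec_add, Matrix.mulVec_mulVec, Matrix.mul_assoc, hQ'Q,
    Matrix.mul_one, ← Matrix.mulVec_mulVec]

end Rescaling

/-! ### Assembly of the main theorem -/

open Matrix in
theorem mainTheorem1 (m : ℕ) (A : Matrix (Fin m) (Fin m) ℤ) (hA : IsDilationMatrix A)
    (hrat : ∀ μ : ℂ, IsEigenvalueOf A μ → ∃ r : ℚ, μ = (r : ℂ)) :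
    ∃ D : Set (Fin m → ℤ), IsDigitSet A D ∧
      ∃ T : Set (Fin m → ℝ), IsAttractor A D T ∧ (∀ K, IsAttractor A D K → K = T) ∧
        IsConnected T := by
  obtain ⟨P, P', M, h, hPP', hP'P, hAP, htri, hdiag⟩ := exists_integer_triangularization A hA hrat
  have hdiag0 : ∀ i, M i i ≠ 0 := fun i hi => by
    have := hdiag i
    rw [hi, abs_zero] at this
    omega
  obtain ⟨r, hrpos, hrcop, hoff⟩ := exists_rescaling htri hdiag0
  refine ⟨_, isDigitSet_image_digitBox hPP' hP'P hAP htri hdiag0 hrcop, ?_⟩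
  have hr0 : ∀ i, (r i : ℝ) ≠ 0 := fun i => by exact_mod_cast (hrpos i).ne'
  let cast : Matrix (Fin m) (Fin m) ℤ →+* Matrix (Fin m) (Fin m) ℝ :=
    (Int.castRingHom ℝ).mapMatrix
  let S : Matrix (Fin m) (Fin m) ℝ := diagonal fun i => (r i : ℝ)
  let S' : Matrix (Fin m) (Fin m) ℝ := diagonal fun i => (r i : ℝ)⁻¹
  have hSS' : S * S' = 1 := by simp [S, S', hr0]
  have hS'S : S' * S = 1 := by simp [S, S', hr0]
  have hPr : cast P * cast P' = 1 := by rw [← map_mul, hPP', map_one]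
  have hPr' : cast P' * cast P = 1 := by rw [← map_mul, hP'P, map_one]
  let B : Matrix (Fin m) (Fin m) ℝ := S' * cast M * S
  have hBij : ∀ i j, B i j = (M i j : ℝ) * r j / r i := by
    intro i j
    simp [B, S, S', cast, Matrix.mul_diagonal, Matrix.diagonal_mul]
    ring
  have hQQ' : cast P * S * (S' * cast P') = 1 := by
    rw [Matrix.mul_assoc, ← Matrix.mul_assoc S, hSS', Matrix.one_mul, hPr]
  have hQ'Q : S' * cast P' * (cast P * S) = 1 := by
    rw [Matrix.mul_assoc, ← Matrix.mul_assoc (cast P'), hPr', Matrix.one_mul, hS'S]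
  have hAQ : A.map (Int.cast : ℤ → ℝ) = cast P * S * B * (S' * cast P') := by
    calc A.map (Int.cast : ℤ → ℝ) = cast (P * M * P') := by rw [← hAP]; rfl
      _ = cast P * (S * S') * cast M * (S * S') * cast P' := by
        rw [hSS', Matrix.mul_one, Matrix.mul_one, map_mul, map_mul]
      _ = cast P * S * B * (S' * cast P') := by simp only [B, Matrix.mul_assoc]
  have hBdiag : ∀ i, B i i = M i i := fun i => by rw [hBij]; field_simp [hr0 i]
  have hBtri : ∀ i j, B i j ≠ 0 → i = j ∨ h i < h j := by
    intro i j hij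
    refine htri i j fun h0 => hij ?_
    simp [hBij, h0]
  have hBoff : ∀ i, ∑ j ∈ Finset.univ.erase i, |B i j| ≤ 1 / 4 := by
    intro i
    simpa only [hBij] using hoff i
  have hBunit : IsUnit B.det := isUnit_det_of_norm_le (norm_le_norm_mulVec hBdiag hdiag hBoff)
  obtain ⟨T, hT, huniq, hconn⟩ :=
    exists_connected_attractor_digitBox hBdiag hdiag hBtri hBoff
  -- The coordinate change `P S` conjugates `B` to `A` and sends the digit `k` to `P (r * k)`, so
  -- attractors correspond.
  let Q := mulVecHomeomorph _ _ hQQ' hQ'Q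
  have hQ : ∀ (k : Fin m → ℤ) (x : Fin m → ℝ), digitMap A (P *ᵥ (r * k)) (Q x) =
      Q (B⁻¹ *ᵥ (x + fun i => (k i : ℝ))) := by
    intro k x
    refine digitMap_mulVec hQQ' hQ'Q hBunit hAQ ?_ x
    funext i
    rw [← Matrix.mulVec_mulVec]
    simp [Matrix.mulVec, dotProduct, cast, S, Matrix.diagonal_apply]
  refine ⟨Q '' T, (isAttractor_image_iff Q hQ T).2 hT, fun K hK => ?_,
    hconn.image _ Q.continuous.continuousOn⟩
  have hKim : Q '' (Q.symm '' K) = K := by simp [Set.image_image]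
  rw [← hKim] at hK ⊢
  obtain ⟨h1, h2, h3⟩ := (isAttractor_image_iff Q hQ _).1 hK
  rw [huniq _ h1 h2 h3]
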